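/- Let $n\ge 0$, let $-1<y_1<\dots<y_n<1$ and $g_1,\dots,g_n>0$, and consider the discrete dual cubic string with mass distribution $g=\sum_{k=1}^n g_k\delta_{y_k}$, i.e. for $\lambda\in\mathbb C$ the system $$\partial_y\phi_1=g\,\phi_2,\qquad \partial_y\phi_2=g\,\phi_3,\qquad \partial_y\phi_3=-\lambda\,\phi_1\qquad(-1<y<1),$$ for complex-valued $\Phi=(\phi_1,\phi_2,\phi_3)$, with boundary conditions $\phi_2(-1)=\phi_3(-1)=0$ and $\phi_3(1)=0$. Here the system means: off the points $y_k$ one has $\phi_1'=\phi_2'=0$ and $\phi_3'=-\lambda\phi_1$; $\phi_3$ is continuous; and at each $y_k$ the one-sided limits of $\phi_1,\phi_2$ exist and satisfy $$\phi_1(y_k^+)-\phi_1(y_k^-)=g_k\,\frac{\phi_2(y_k^-)+\phi_2(y_k^+)}{2},\qquad \phi_2(y_k^+)-\phi_2(y_k^-)=g_k\,\phi_3(y_k).$$ The values at $\pm1$ are the limits from inside the interval, and the values of $\phi_1,\phi_2$ at the points $y_k$ themselves are disregarded. The spectrum is the set of $\lambda\in\mathbb C$ for which the boundary value problem has a nontrivial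 solution (an eigenfunction). Then for every $\lambda\in\mathbb C$ there is a unique solution $\Phi(y;\lambda)$ of the system with $\Phi(-1;\lambda)=(1,0,0)$. Define the Weyl functions $$W(\lambda)=-\frac{\phi_2(1;\lambda)}{\phi_3(1;\lambda)},\qquad Z(\lambda)=-\frac{\phi_1(1;\lambda)}{\phi_3(1;\lambda)}.$$ The following hold. 1. The spectrum consists of $n+1$ real numbers $0=\lambda_0<\lambda_1<\dots<\lambda_n$, and it is simple: every eigenfunction for $\lambda_j$ is a scalar multiple of $\Phi(\cdot;\lambda_j)$, and each $\lambda_j$ is a simple zero of $\lambda\mapsto\phi_3(1;\lambda)$. 2. There are real numbers $b_k>0$ and $c_k>0$ $(1\le k\le n)$ such that, for all $\lambda$ outside the spectrum, $$W(\lambda)=\sum_{k=1}^n\frac{b_k}{\lambda-\lambda_k},\qquad Z(\lambda)=\frac1{2\lambda}+\sum_{k=1}^n\frac{c_k}{\lambda-\lambda_k},$$ and $$c_k=\sum_{m=1}^n\frac{b_m b_k}{\lambda_m+\lambda_k}\qquad(1\le k\le n).$$ 3. $Z(\lambda)+Z(-\lambda)+W(\lambda)W(-\lambda)=0$ whenever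 neither $\lambda$ nor $-\lambda$ lies in the spectrum. 4. $Z$ is uniquely determined by $W$: if two discrete dual cubic strings with positive masses (possibly with different numbers of masses) have Weyl functions $W$ that agree outside the union of their spectra, then their Weyl functions $Z$ agree there as well. -/

import Mathlib

open Filter Topology Set

/-- A discrete dual cubic string on the interval `-1 < y < 1`: the measure
`g = ∑ k, g k • δ_(y k)` with `n` point masses at positions `-1 < y 0 < ⋯ < y (n - 1) < 1`.
No sign is imposed on the masses here. -/
structure DualCubicString (n : ℕ) where
  /-- positions of the point masses -/
  y : Fin n → ℝ
  /-- the point masses -/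
  g : Fin n → ℝ
  y_strictMono : StrictMono y
  neg_one_lt_y : ∀ k, -1 < y k
  y_lt_one : ∀ k, y k < 1

namespace DualCubicString

variable {n : ℕ} (S : DualCubicString n)

/-- `Φ = (φ₁, φ₂, φ₃)` (components numbered `0, 1, 2`) solves the system
`φ₁' = g φ₂`, `φ₂' = g φ₃`, `φ₃' = -lam φ₁` on `[-1, 1]`, where `g = ∑ k, g k • δ_(y k)`.
Away from the masses the system reads `φ₁' = 0`, `φ₂' = 0`, `φ₃' = -lam φ₁`. At a mass, `φ₃` is
continuous, `φ₁` and `φ₂` have one-sided limits, and the product `φ₂ δ_(y k)` is read as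
`⟨φ₂(y k)⟩ δ_(y k)`, where `⟨ ⟩` is the average of the two one-sided limits.
The values at `±1` are the limits from inside the interval. The values of `φ₁` and `φ₂`
exactly at the masses, and of `Φ` outside `[-1, 1]`, are irrelevant. -/
structure IsSolution (lam : ℂ) (Φ : ℝ → Fin 3 → ℂ) : Prop where
  hasDerivAt_one : ∀ y ∈ Ioo (-1 : ℝ) 1, y ∉ range S.y →
    HasDerivAt (fun t => Φ t 0) 0 y
  hasDerivAt_two : ∀ y ∈ Ioo (-1 : ℝ) 1, y ∉ range S.y →
    HasDerivAt (fun t => Φ t 1) 0 y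
  hasDerivAt_three : ∀ y ∈ Ioo (-1 : ℝ) 1, y ∉ range S.y →
    HasDerivAt (fun t => Φ t 2) (-lam * Φ y 0) y
  continuousAt_three : ∀ k, ContinuousAt (fun t => Φ t 2) (S.y k)
  jump : ∀ k, ∃ p₁ q₁ p₂ q₂ : ℂ,
    Tendsto (fun t => Φ t 0) (𝓝[<] S.y k) (𝓝 p₁) ∧
    Tendsto (fun t => Φ t 0) (𝓝[>] S.y k) (𝓝 q₁) ∧
    Tendsto (fun t => Φ t 1) (𝓝[<] S.y k) (𝓝 p₂) ∧
    Tendsto (fun t => Φ t 1) (𝓝[>] S.y k) (𝓝 q₂) ∧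
    q₁ - p₁ = (S.g k : ℂ) * ((p₂ + q₂) / 2) ∧
    q₂ - p₂ = (S.g k : ℂ) * Φ (S.y k) 2
  continuous_left : ContinuousWithinAt Φ (Ici (-1)) (-1)
  continuous_right : ContinuousWithinAt Φ (Iic 1) 1

/-- A nontrivial solution (nonzero somewhere off the masses) with the boundary conditions
`φ₂(-1) = φ₃(-1) = 0`, `φ₃(1) = 0`. -/
def IsEigenfunction (lam : ℂ) (Φ : ℝ → Fin 3 → ℂ) : Prop :=
  S.IsSolution lam Φ ∧ Φ (-1) 1 = 0 ∧ Φ (-1) 2 = 0 ∧ Φ 1 2 = 0 ∧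
    ∃ y ∈ Icc (-1 : ℝ) 1, y ∉ range S.y ∧ Φ y ≠ 0

/-- The spectrum: the set of (complex) eigenvalues of the boundary value problem. -/
def spectrum : Set ℂ := {lam | ∃ Φ, S.IsEigenfunction lam Φ}

/-- A solution with the initial value `Φ(-1) = (1, 0, 0)`. -/
def IsNormalizedSolution (lam : ℂ) (Φ : ℝ → Fin 3 → ℂ) : Prop :=
  S.IsSolution lam Φ ∧ Φ (-1) = ![1, 0, 0]

/-- `S.phi lam y = Φ(y; lam)`, the solution with `Φ(-1; lam) = (1, 0, 0)`. -/
noncomputable def phi (lam : ℂ) : ℝ → Fin 3 → ℂ :=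
  Classical.epsilon (S.IsNormalizedSolution lam)

/-- The first Weyl function `W = -φ₂(1; lam) / φ₃(1; lam)`. -/
noncomputable def weylW (lam : ℂ) : ℂ := -(S.phi lam 1 1 / S.phi lam 1 2)

/-- The second Weyl function `Z = -φ₁(1; lam) / φ₃(1; lam)`. -/
noncomputable def weylZ (lam : ℂ) : ℂ := -(S.phi lam 1 0 / S.phi lam 1 2)

end DualCubicString

/-!
Between two masses, and across a mass, a solution is moved by explicit transfer maps, so the
components of `Φ(1; lam)` are polynomials in `lam`. Let `B` be an alternating form for which
multiplication by `lam` behaves as a spectral parameter does. Six sign conditions on the values of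
`B` at the components of `Φ` hold at `-1` and propagate along the string, and
`B (φ₃(1), φ₁(1))` is bounded below by `B (1, lam)` times the length of the first interval. For the
form `Im lam * Im (conj f * g)` this bound says that the zeros of `φ₃(1; ·)` are real; for the
Wronskian in the real variable `lam` it says that they are simple and that the residues of `Z` at
them are positive.

The pairing `φ₁ ψ₃ - φ₂ ψ₂ + φ₃ ψ₁` of solutions `Φ` for `lam` and `Ψ` for `-lam` is constant along
the string, which gives `Z(lam) + Z(-lam) + W(lam) W(-lam) = 0`. Its residue at `lam = λₖ` is
`cₖ = -bₖ W(-λₖ)`; this is the formula for `cₖ`, and it makes `bₖ` positive because the components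
of `Φ(1; lam)` are nonnegative for `lam < 0`. Finally, the difference of two functions `Z` with the
same `W` is odd, vanishes at infinity and has only simple poles, all of them positive, so it is `0`.
-/

section PartialFractions

open Polynomial

lemma splits_of_forall_im_eq_zero {P : ℝ[X]} (h : ∀ z : ℂ, aeval z P = 0 → z.im = 0) :
    P.Splits := by
  refine .of_splits_map (algebraMap ℝ ℂ) (IsAlgClosed.splits _) fun z hz => ?_
  have hPz : aeval z P = 0 := by
    simpa only [IsRoot.def, eval_map_algebraMap] using isRoot_of_mem_roots hz
  exact ⟨z.re, Complex.ext rfl (h z hPz).symm⟩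

lemma eq_C_mul_nodal_roots {F : Type*} [Field F] [DecidableEq F] {Q : F[X]} (hQ : Q.Splits)
    (hnodup : Q.roots.Nodup) :
    Q = C Q.leadingCoeff * Lagrange.nodal Q.roots.toFinset id := by
  conv_lhs => rw [hQ.eq_prod_roots]
  rw [Lagrange.nodal_eq, Finset.prod, Multiset.toFinset_val, hnodup.dedup]
  rfl

lemma aeval_div_aeval_eq_sum_roots {F L : Type*} [Field F] [DecidableEq F] [Field L] [Algebra F L]
    {P Q : F[X]} (hQ : Q.Splits) (hnodup : Q.roots.Nodup) (hdeg : P.degree < Q.degree) {x : L}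
    (hx : aeval x Q ≠ 0) :
    aeval x P / aeval x Q = ∑ r ∈ Q.roots.toFinset,
      algebraMap F L (P.eval r / (derivative Q).eval r) / (x - algebraMap F L r) := by
  set s := Q.roots.toFinset with hs
  have hQs : Q = C Q.leadingCoeff * Lagrange.nodal s id := eq_C_mul_nodal_roots hQ hnodup
  have hcard : Q.degree = s.card := by
    rw [hQ.degree_eq_card_roots (ne_zero_of_degree_gt hdeg), hs,
      Multiset.toFinset_card_of_nodup hnodup]
  have hP : P = ∑ r ∈ s, C (P.eval r / (Lagrange.nodal s id).derivative.eval r) *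
      Lagrange.nodal (s.erase r) id := by
    conv_lhs =>
      rw [Lagrange.eq_interpolate (f := P) (s := s) (v := id) (Set.injOn_id _) (hcard ▸ hdeg),
        Lagrange.interpolate_eq_nodalWeight_mul_nodal_div_X_sub_C]
    refine Finset.sum_congr rfl fun r hr => ?_
    rw [Lagrange.nodal_erase_eq_nodal_div hr, Lagrange.nodalWeight_eq_eval_derivative_nodal hr,
      mul_right_comm, ← C_mul, id, ← div_eq_inv_mul]
  rw [congrArg (aeval x) hP, map_sum, Finset.sum_div]
  refine Finset.sum_congr rfl fun r hr => ?_
  have hQr : Q = C Q.leadingCoeff * ((X - C r) * Lagrange.nodal (s.erase r) id) :=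
    hQs.trans (congrArg (C Q.leadingCoeff * ·) (Lagrange.nodal_eq_mul_nodal_erase hr))
  have hQ' : Q.derivative.eval r =
      Q.leadingCoeff * (Lagrange.nodal s id).derivative.eval r := by
    conv_lhs => rw [hQs, derivative_C_mul, eval_C_mul]
  rw [congrArg (aeval x) hQr] at hx ⊢
  simp only [map_mul, map_sub, aeval_C, aeval_X] at hx ⊢
  rw [hQ', map_div₀, map_div₀, map_mul]
  field_simp [left_ne_zero_of_mul hx, left_ne_zero_of_mul (right_ne_zero_of_mul hx),
    right_ne_zero_of_mul (right_ne_zero_of_mul hx)]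

variable {K : Type*} [Field K]

/-- The value at `x` of the rational function `∑ a, d a / (x - a)`, as a linear function of the
coefficients `d`. -/
noncomputable def simplePoleSum (x : K) : (K →₀ K) →ₗ[K] K :=
  Finsupp.linearCombination K fun a => (x - a)⁻¹

lemma simplePoleSum_single (x a r : K) : simplePoleSum x (Finsupp.single a r) = r / (x - a) := by
  rw [simplePoleSum, Finsupp.linearCombination_single, smul_eq_mul, div_eq_mul_inv]

lemma simplePoleSum_neg_left (x : K) (d : K →₀ K) :
    simplePoleSum (-x) d = -simplePoleSum x (d.mapDomain Neg.neg) := by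
  rw [simplePoleSum, simplePoleSum, Finsupp.linearCombination_mapDomain,
    Finsupp.linearCombination_apply, Finsupp.linearCombination_apply, Finsupp.sum, Finsupp.sum,
    ← Finset.sum_neg_distrib]
  refine Finset.sum_congr rfl fun a _ => ?_
  rw [Function.comp_apply, ← smul_neg, ← inv_neg, neg_sub', neg_neg]

lemma simplePoleSum_mul_eval_nodal [DecidableEq K] {x : K} {d : K →₀ K} (hx : x ∉ d.support) :
    simplePoleSum x d * (Lagrange.nodal d.support id).eval x =
      (∑ a ∈ d.support, C (d a) * Lagrange.nodal (d.support.erase a) id).eval x := by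
  rw [simplePoleSum, Finsupp.linearCombination_apply, Finsupp.sum, Finset.sum_mul, eval_finsetSum]
  refine Finset.sum_congr rfl fun a ha => ?_
  have hxa : x - a ≠ 0 := sub_ne_zero.2 fun h => hx (h ▸ ha)
  rw [Lagrange.nodal_eq_mul_nodal_erase ha, eval_mul, eval_mul, eval_C, eval_sub, eval_X, eval_C,
    id, smul_eq_mul, mul_assoc, inv_mul_cancel_left₀ hxa]

lemma eq_zero_of_simplePoleSum_eq_zero [Infinite K] {d : K →₀ K}
    (h : ∀ᶠ x in cofinite, simplePoleSum x d = 0) : d = 0 := by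
  classical
  set N : K[X] := ∑ a ∈ d.support, C (d a) * Lagrange.nodal (d.support.erase a) id with hN
  have hroot : ∀ᶠ x in cofinite, N.IsRoot x := by
    filter_upwards [h, d.support.finite_toSet.compl_mem_cofinite] with x hx hxd
    rw [IsRoot.def, hN, ← simplePoleSum_mul_eval_nodal hxd, hx, zero_mul]
  have hN0 : N = 0 := eq_zero_of_infinite_isRoot N (frequently_cofinite_iff_infinite.1
    hroot.frequently)
  by_contra hd
  obtain ⟨a, ha⟩ := Finsupp.support_nonempty_iff.2 hd
  have hNa : N.eval a = d a * (Lagrange.nodal (d.support.erase a) id).eval a := by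
    rw [hN, eval_finsetSum, Finset.sum_eq_single_of_mem a ha, eval_C_mul]
    intro b _ hba
    rw [eval_C_mul, ← id_eq a, Lagrange.eval_nodal_at_node (Finset.mem_erase.2 ⟨hba.symm, ha⟩),
      mul_zero]
  rw [hN0, eval_zero, eq_comm, mul_eq_zero] at hNa
  refine hNa.elim (Finsupp.mem_support_iff.1 ha)
    (Lagrange.eval_nodal_not_at_node fun b hb => ?_)
  exact (Finset.ne_of_mem_erase hb).symm

lemma eq_zero_of_simplePoleSum_odd [Infinite K] {d : K →₀ K}
    (hodd : ∀ᶠ x in cofinite, simplePoleSum x d + simplePoleSum (-x) d = 0)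
    (hd : ∀ a ∈ d.support, -a ∉ d.support) : d = 0 := by
  have hsymm : d = d.mapDomain Neg.neg := by
    rw [← sub_eq_zero]
    refine eq_zero_of_simplePoleSum_eq_zero (hodd.mono fun x hx => ?_)
    rwa [map_sub, sub_eq_add_neg, ← simplePoleSum_neg_left]
  ext a
  by_contra ha
  have hneg : d (-a) = d a := by
    rw [DFunLike.congr_fun hsymm (-a), Finsupp.mapDomain_apply neg_injective]
  exact hd a (Finsupp.mem_support_iff.2 ha) (Finsupp.mem_support_iff.2 (hneg ▸ ha))

end PartialFractions

section Transfer

variable {R : Type*} [CommRing R] [Algebra ℝ R]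

/-- The transfer map of a mass-free interval of length `l`: it takes the value of a solution at the
left end of the interval to its value at the right end. The coefficient ring is arbitrary so that
`lam` can be a number or a polynomial variable. -/
def drift (lam : R) (l : ℝ) (v : Fin 3 → R) : Fin 3 → R :=
  ![v 0, v 1, v 2 - l • (lam * v 0)]

/-- The transfer map of a point mass `g`: it takes the left limit of a solution to its right limit.
Here `v 1 + (g / 2) • v 2` is the average of the one-sided limits of the second component. -/
noncomputable def massJump (g : ℝ) (v : Fin 3 → R) : Fin 3 → R :=
  ![v 0 + g • (v 1 + (g / 2) • v 2), v 1 + g • v 2, v 2]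

@[simp] lemma drift_zero (lam : R) (l : ℝ) (v : Fin 3 → R) : drift lam l v 0 = v 0 := rfl

@[simp] lemma drift_one (lam : R) (l : ℝ) (v : Fin 3 → R) : drift lam l v 1 = v 1 := rfl

@[simp] lemma drift_two (lam : R) (l : ℝ) (v : Fin 3 → R) :
    drift lam l v 2 = v 2 - l • (lam * v 0) := rfl

@[simp] lemma massJump_zero (g : ℝ) (v : Fin 3 → R) :
    massJump g v 0 = v 0 + g • (v 1 + (g / 2) • v 2) := rfl

@[simp] lemma massJump_one (g : ℝ) (v : Fin 3 → R) : massJump g v 1 = v 1 + g • v 2 := rfl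

@[simp] lemma massJump_two (g : ℝ) (v : Fin 3 → R) : massJump g v 2 = v 2 := rfl

lemma funext_fin_three {α : Type*} {v w : Fin 3 → α} (h₀ : v 0 = w 0) (h₁ : v 1 = w 1)
    (h₂ : v 2 = w 2) : v = w :=
  funext (Fin.forall_fin_succ.2 ⟨h₀, Fin.forall_fin_two.2 ⟨h₁, h₂⟩⟩)

lemma drift_smul (lam a : R) (l : ℝ) (v : Fin 3 → R) :
    drift lam l (a • v) = a • drift lam l v :=
  funext_fin_three rfl rfl <| by
    simp only [drift_two, Pi.smul_apply, smul_eq_mul, mul_sub, mul_smul_comm, mul_left_comm]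

lemma massJump_smul (a : R) (g : ℝ) (v : Fin 3 → R) : massJump g (a • v) = a • massJump g v :=
  funext_fin_three
    (by simp only [massJump_zero, Pi.smul_apply, smul_eq_mul, mul_add, mul_smul_comm])
    (by simp only [massJump_one, Pi.smul_apply, smul_eq_mul, mul_add, mul_smul_comm]) rfl

lemma map_comp_drift {R' : Type*} [CommRing R'] [Algebra ℝ R'] (f : R →ₐ[ℝ] R') (lam : R) (l : ℝ)
    (v : Fin 3 → R) : f ∘ drift lam l v = drift (f lam) l (f ∘ v) :=
  funext_fin_three rfl rfl <| by
    simp only [Function.comp_apply, drift_two, map_sub, map_smul, map_mul]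

lemma map_comp_massJump {R' : Type*} [CommRing R'] [Algebra ℝ R'] (f : R →ₐ[ℝ] R') (g : ℝ)
    (v : Fin 3 → R) : f ∘ massJump g v = massJump g (f ∘ v) :=
  funext_fin_three (by simp only [Function.comp_apply, massJump_zero, map_add, map_smul])
    (by simp only [Function.comp_apply, massJump_one, map_add, map_smul]) rfl

/-- The symmetric bilinear pairing `v₁ w₃ - v₂ w₂ + v₃ w₁` of state vectors, invariant when `v`
evolves with the spectral parameter `lam` and `w` with `-lam`. -/
def statePairing (v w : Fin 3 → R) : R := v 0 * w 2 - v 1 * w 1 + v 2 * w 0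

lemma statePairing_drift_drift_neg (lam : R) (l : ℝ) (v w : Fin 3 → R) :
    statePairing (drift lam l v) (drift (-lam) l w) = statePairing v w := by
  simp only [statePairing, drift_zero, drift_one, drift_two, Algebra.smul_def]
  ring

lemma statePairing_massJump_massJump (g : ℝ) (v w : Fin 3 → R) :
    statePairing (massJump g v) (massJump g w) = statePairing v w := by
  have hg : algebraMap ℝ R g = 2 * algebraMap ℝ R (g / 2) := by
    rw [← map_ofNat (algebraMap ℝ R) 2, ← map_mul, mul_div_cancel₀ g two_ne_zero]
  simp only [statePairing, massJump_zero, massJump_one, massJump_two, Algebra.smul_def, hg]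
  ring

/-- An alternating real form on an algebra, together with an element `lam` whose multiplication
operator behaves as a spectral parameter does: the sign of the form detects non-real values of `lam`
or the direction of its motion. -/
structure IsSpectralForm (B : R →ₗ[ℝ] R →ₗ[ℝ] ℝ) (lam : R) : Prop where
  isAlt : B.IsAlt
  apply_mul_self_nonneg (f : R) : 0 ≤ B f (lam * f)
  apply_mul_mul_nonneg {f g : R} : 0 ≤ B f g → 0 ≤ B (lam * f) (lam * g)

/-- The sign conditions that the components of a solution satisfy with respect to a form. They are
preserved by the transfer maps of the string and imply interlacing of zeros. -/
structure Interlaced (B : R →ₗ[ℝ] R →ₗ[ℝ] ℝ) (lam : R) (v : Fin 3 → R) : Prop where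
  one_zero : 0 ≤ B (v 1) (v 0)
  two_zero : 0 ≤ B (v 2) (v 0)
  two_one : 0 ≤ B (v 2) (v 1)
  one_mul_zero : 0 ≤ B (v 1) (lam * v 0)
  two_mul_zero : 0 ≤ B (v 2) (lam * v 0)
  two_mul_one : 0 ≤ B (v 2) (lam * v 1)

namespace Interlaced

variable {B : R →ₗ[ℝ] R →ₗ[ℝ] ℝ} {lam : R} {v : Fin 3 → R} {a : ℝ}

lemma add_smul_one (h : Interlaced B lam v) (hB : IsSpectralForm B lam) (ha : 0 ≤ a) :
    Interlaced B lam ![v 0 + a • v 1, v 1, v 2] where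
  one_zero := by simpa [hB.isAlt.self_eq_zero] using h.one_zero
  two_zero := by simpa using add_nonneg h.two_zero (mul_nonneg ha h.two_one)
  two_one := h.two_one
  one_mul_zero := by
    simpa [mul_add] using
      add_nonneg h.one_mul_zero (mul_nonneg ha (hB.apply_mul_self_nonneg (v 1)))
  two_mul_zero := by
    simpa [mul_add] using add_nonneg h.two_mul_zero (mul_nonneg ha h.two_mul_one)
  two_mul_one := h.two_mul_one

lemma add_smul_two (h : Interlaced B lam v) (hB : IsSpectralForm B lam) (ha : 0 ≤ a) :
    Interlaced B lam ![v 0, v 1 + a • v 2, v 2] where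
  one_zero := by simpa using add_nonneg h.one_zero (mul_nonneg ha h.two_zero)
  two_zero := h.two_zero
  two_one := by simpa [hB.isAlt.self_eq_zero] using h.two_one
  one_mul_zero := by simpa using add_nonneg h.one_mul_zero (mul_nonneg ha h.two_mul_zero)
  two_mul_zero := h.two_mul_zero
  two_mul_one := by
    simpa [mul_add] using
      add_nonneg h.two_mul_one (mul_nonneg ha (hB.apply_mul_self_nonneg (v 2)))

-- The jump is a composition of three shears because of the averaging convention at a mass.
lemma massJump (h : Interlaced B lam v) (hB : IsSpectralForm B lam) (ha : 0 ≤ a) :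
    Interlaced B lam (massJump a v) := by
  have ha₂ : 0 ≤ a / 2 := div_nonneg ha zero_le_two
  convert ((h.add_smul_two hB ha₂).add_smul_one hB ha).add_smul_two hB ha₂ using 1
  exact funext_fin_three rfl (by simp [add_assoc, ← add_smul]) rfl

lemma drift (h : Interlaced B lam v) (hB : IsSpectralForm B lam) (ha : 0 ≤ a) :
    Interlaced B lam (drift lam a v) where
  one_zero := h.one_zero
  two_zero := by
    simpa [← hB.isAlt.neg (v 0)] using
      add_nonneg h.two_zero (mul_nonneg ha (hB.apply_mul_self_nonneg (v 0)))
  two_one := by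
    simpa [← hB.isAlt.neg (v 1)] using add_nonneg h.two_one (mul_nonneg ha h.one_mul_zero)
  one_mul_zero := h.one_mul_zero
  two_mul_zero := by simpa [hB.isAlt.self_eq_zero] using h.two_mul_zero
  two_mul_one := by
    simpa [← hB.isAlt.neg (lam * v 1)] using
      add_nonneg h.two_mul_one (mul_nonneg ha (hB.apply_mul_mul_nonneg h.one_zero))

lemma apply_two_zero_le_massJump (h : Interlaced B lam v) (hB : IsSpectralForm B lam)
    (ha : 0 ≤ a) : B (v 2) (v 0) ≤ B (_root_.massJump a v 2) (_root_.massJump a v 0) := by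
  simpa [hB.isAlt.self_eq_zero] using mul_nonneg ha h.two_one

end Interlaced

lemma apply_drift_two_zero {B : R →ₗ[ℝ] R →ₗ[ℝ] ℝ} (hB : B.IsAlt) (lam : R) (l : ℝ)
    (v : Fin 3 → R) : B (drift lam l v 2) (drift lam l v 0) =
      B (v 2) (v 0) + l * B (v 0) (lam * v 0) := by
  simp [← hB.neg (v 0)]

end Transfer

section SpectralForms

open Polynomial ComplexConjugate

attribute [local instance] Complex.finrank_real_complex_fact in
lemma isSpectralForm_im_smul_areaForm (z : ℂ) :
    IsSpectralForm (z.im • Complex.orientation.areaForm) z where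
  isAlt f := by simp
  apply_mul_self_nonneg f := by
    have hf : z.im * (conj f * (z * f)).im = z.im ^ 2 * Complex.normSq f := by
      rw [mul_left_comm, ← Complex.normSq_eq_conj_mul_self, Complex.im_mul_ofReal]
      ring
    simpa only [LinearMap.smul_apply, smul_eq_mul, Complex.areaForm, hf] using
      mul_nonneg (sq_nonneg z.im) (Complex.normSq_nonneg f)
  apply_mul_mul_nonneg {f g} h := by
    have hfg : z.im * (conj (z * f) * (z * g)).im =
        Complex.normSq z * (z.im * (conj f * g).im) := by
      rw [map_mul, mul_mul_mul_comm, ← Complex.normSq_eq_conj_mul_self, Complex.im_ofReal_mul]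
      ring
    simp only [LinearMap.smul_apply, smul_eq_mul, Complex.areaForm, hfg] at h ⊢
    exact mul_nonneg (Complex.normSq_nonneg z) h

lemma isSpectralForm_wronskianBilin (t : ℝ) :
    IsSpectralForm ((wronskianBilin ℝ).compr₂ (leval t)) X where
  isAlt f := by simp [wronskian_self_eq_zero]
  apply_mul_self_nonneg f := by
    have hW : wronskian f (X * f) = f ^ 2 := by
      rw [wronskian, derivative_mul, derivative_X]
      ring
    simpa [hW] using sq_nonneg (f.eval t)
  apply_mul_mul_nonneg {f g} h := by
    have hW : wronskian (X * f) (X * g) = X ^ 2 * wronskian f g := by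
      rw [wronskian, wronskian, derivative_mul, derivative_mul, derivative_X]
      ring
    simpa [hW] using mul_nonneg (sq_nonneg t) h

end SpectralForms

section Calculus

lemma eq_of_hasDerivAt_zero_of_tendsto {E : Type*} [NormedAddCommGroup E] [NormedSpace ℝ E]
    {f : ℝ → E} {a b : ℝ} {p : E} (hf : ∀ y ∈ Ioo a b, HasDerivAt f 0 y)
    (hp : Tendsto f (𝓝[>] a) (𝓝 p)) {y : ℝ} (hy : y ∈ Ioo a b) : f y = p := by
  obtain ⟨c, hc⟩ := isOpen_Ioo.exists_is_const_of_deriv_eq_zero isPreconnected_Ioo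
    (fun t ht => (hf t ht).differentiableAt.differentiableWithinAt) (fun t ht => (hf t ht).deriv)
  have hev : f =ᶠ[𝓝[>] a] fun _ => c := eventually_of_mem (Ioo_mem_nhdsGT (hy.1.trans hy.2)) hc
  rw [hc y hy]
  exact tendsto_nhds_unique (tendsto_const_nhds.congr' hev.symm) hp

lemma drift_zero_length {R : Type*} [CommRing R] [Algebra ℝ R] (lam : R) (v : Fin 3 → R) :
    drift lam 0 v = v :=
  funext_fin_three rfl rfl <| by rw [drift_two, zero_smul, sub_zero]

lemma hasDerivAt_drift_sub_two (lam : ℂ) (a : ℝ) (v : Fin 3 → ℂ) (y : ℝ) :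
    HasDerivAt (fun t : ℝ => drift lam (t - a) v 2) (-lam * v 0) y := by
  simpa only [drift_two, id, one_smul, neg_mul] using
    (((hasDerivAt_id y).sub_const a).smul_const (lam * v 0)).const_sub (v 2)

lemma continuous_drift_sub (lam : ℂ) (a : ℝ) (v : Fin 3 → ℂ) :
    Continuous fun t : ℝ => drift lam (t - a) v := by
  refine continuous_pi (Fin.forall_fin_succ.2 ⟨continuous_const, Fin.forall_fin_two.2
    ⟨continuous_const, continuous_iff_continuousAt.2 fun t => ?_⟩⟩)
  exact (hasDerivAt_drift_sub_two lam a v t).continuousAt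

end Calculus

namespace DualCubicString

open Polynomial

variable {n : ℕ} (S : DualCubicString n)

section Nodes

/-- The points `-1, y 0, …, y (n - 1), 1`, continued by `1`, so that the mass `y k` is the node
`k + 1`. -/
noncomputable def node : ℕ → ℝ
  | 0 => -1
  | k + 1 => if h : k < n then S.y ⟨k, h⟩ else 1

/-- The point masses indexed by natural numbers, continued by `0`. -/
noncomputable def mass (k : ℕ) : ℝ := if h : k < n then S.g ⟨k, h⟩ else 0

/-- The length of the mass-free interval between the nodes `k` and `k + 1`. -/
noncomputable def gap (k : ℕ) : ℝ := S.node (k + 1) - S.node k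

lemma node_zero : S.node 0 = -1 := rfl

lemma node_succ {k : ℕ} (h : k < n) : S.node (k + 1) = S.y ⟨k, h⟩ := dif_pos h

lemma node_add_one (k : Fin n) : S.node (k + 1) = S.y k := S.node_succ k.2

lemma node_last : S.node (n + 1) = 1 := dif_neg (lt_irrefl n)

lemma mass_coe (k : Fin n) : S.mass k = S.g k := dif_pos k.2

lemma node_lt_succ {k : ℕ} (hk : k ≤ n) : S.node k < S.node (k + 1) := by
  rcases hk.lt_or_eq with h | rfl
  · rw [S.node_succ h]
    cases k with
    | zero => exact S.neg_one_lt_y _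
    | succ k =>
      rw [S.node_succ (by lia)]
      exact S.y_strictMono (Fin.mk_lt_mk.2 k.lt_succ_self)
  · rw [S.node_last]
    cases k with
    | zero => exact neg_lt_self one_pos
    | succ k =>
      rw [S.node_succ (by lia)]
      exact S.y_lt_one _

lemma node_monotone : Monotone S.node := by
  refine monotone_nat_of_le_succ fun k => ?_
  by_cases hk : k ≤ n
  · exact (S.node_lt_succ hk).le
  · obtain ⟨m, rfl⟩ : ∃ m, k = m + 1 := ⟨k - 1, by lia⟩
    simp [node, show ¬ m < n by lia, show ¬ m + 1 < n by lia]

lemma gap_nonneg (k : ℕ) : 0 ≤ S.gap k := sub_nonneg.2 (S.node_monotone k.le_succ)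

lemma gap_pos {k : ℕ} (hk : k ≤ n) : 0 < S.gap k := sub_pos.2 (S.node_lt_succ hk)

lemma mass_nonneg (hg : ∀ k, 0 ≤ S.g k) (k : ℕ) : 0 ≤ S.mass k := by
  unfold mass
  split
  · exact hg _
  · exact le_rfl

lemma mass_ne_zero (hg : ∀ k, S.g k ≠ 0) {k : ℕ} (hk : k < n) : S.mass k ≠ 0 :=
  S.mass_coe ⟨k, hk⟩ ▸ hg _

end Nodes

section States

variable {R : Type*} [CommRing R] [Algebra ℝ R]

/-- The right limit at the node `k` of the solution with initial value `v`. -/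
noncomputable def rightState (lam : R) (v : Fin 3 → R) : ℕ → Fin 3 → R
  | 0 => v
  | k + 1 => massJump (S.mass k) (drift lam (S.gap k) (rightState lam v k))

/-- The left limit at the node `k + 1` of the solution with initial value `v`. -/
noncomputable def leftState (lam : R) (v : Fin 3 → R) (k : ℕ) : Fin 3 → R :=
  drift lam (S.gap k) (S.rightState lam v k)

lemma rightState_zero (lam : R) (v : Fin 3 → R) : S.rightState lam v 0 = v := rfl

lemma rightState_succ (lam : R) (v : Fin 3 → R) (k : ℕ) :
    S.rightState lam v (k + 1) = massJump (S.mass k) (S.leftState lam v k) := rfl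

lemma leftState_succ_zero (lam : R) (v : Fin 3 → R) (k : ℕ) :
    S.leftState lam v (k + 1) 0 = S.leftState lam v k 0 +
      S.mass k • (S.leftState lam v k 1 + (S.mass k / 2) • S.leftState lam v k 2) := rfl

lemma leftState_succ_one (lam : R) (v : Fin 3 → R) (k : ℕ) :
    S.leftState lam v (k + 1) 1 = S.leftState lam v k 1 + S.mass k • S.leftState lam v k 2 := rfl

lemma leftState_succ_two (lam : R) (v : Fin 3 → R) (k : ℕ) :
    S.leftState lam v (k + 1) 2 =
      S.leftState lam v k 2 - S.gap (k + 1) • (lam * S.leftState lam v (k + 1) 0) := rfl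

lemma rightState_smul (lam a : R) (v : Fin 3 → R) (k : ℕ) :
    S.rightState lam (a • v) k = a • S.rightState lam v k := by
  induction k with
  | zero => rfl
  | succ k ih => rw [rightState_succ, leftState, ih, drift_smul, massJump_smul]; rfl

lemma map_comp_rightState {R' : Type*} [CommRing R'] [Algebra ℝ R'] (f : R →ₐ[ℝ] R') (lam : R)
    (v : Fin 3 → R) (k : ℕ) :
    f ∘ S.rightState lam v k = S.rightState (f lam) (f ∘ v) k := by
  induction k with
  | zero => rfl
  | succ k ih => rw [rightState_succ, leftState, map_comp_massJump, map_comp_drift, ih]; rfl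

lemma map_comp_leftState {R' : Type*} [CommRing R'] [Algebra ℝ R'] (f : R →ₐ[ℝ] R') (lam : R)
    (v : Fin 3 → R) (k : ℕ) :
    f ∘ S.leftState lam v k = S.leftState (f lam) (f ∘ v) k := by
  rw [leftState, map_comp_drift, map_comp_rightState, leftState]

lemma statePairing_leftState_neg (lam : R) (v w : Fin 3 → R) (k : ℕ) :
    statePairing (S.leftState lam v k) (S.leftState (-lam) w k) = statePairing v w := by
  rw [leftState, leftState, statePairing_drift_drift_neg]
  induction k with
  | zero => rfl
  | succ k ih =>
    rw [rightState_succ, rightState_succ, statePairing_massJump_massJump, leftState, leftState,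
      statePairing_drift_drift_neg, ih]

variable {B : R →ₗ[ℝ] R →ₗ[ℝ] ℝ} {lam : R}

lemma interlaced_rightState (hg : ∀ k, 0 ≤ S.g k) (hB : IsSpectralForm B lam) {v : Fin 3 → R}
    (hv : Interlaced B lam v) (k : ℕ) : Interlaced B lam (S.rightState lam v k) := by
  induction k with
  | zero => exact hv
  | succ k ih => exact (ih.drift hB (S.gap_nonneg k)).massJump hB (S.mass_nonneg hg k)

lemma gap_zero_mul_apply_le_apply_leftState (hg : ∀ k, 0 ≤ S.g k) (hB : IsSpectralForm B lam)
    (k : ℕ) : S.gap 0 * B 1 lam ≤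
      B (S.leftState lam ![1, 0, 0] k 2) (S.leftState lam ![1, 0, 0] k 0) := by
  have hinit : Interlaced B lam ![1, 0, 0] := by constructor <;> simp
  induction k with
  | zero =>
    rw [leftState, rightState_zero, apply_drift_two_zero hB.isAlt]
    simp
  | succ k ih =>
    have hleft : Interlaced B lam (S.leftState lam ![1, 0, 0] k) :=
      (S.interlaced_rightState hg hB hinit k).drift hB (S.gap_nonneg k)
    calc
      _ ≤ _ := ih
      _ ≤ B (S.rightState lam ![1, 0, 0] (k + 1) 2) (S.rightState lam ![1, 0, 0] (k + 1) 0) :=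
        hleft.apply_two_zero_le_massJump hB (S.mass_nonneg hg k)
      _ ≤ _ := by
        rw [leftState, apply_drift_two_zero hB.isAlt]
        exact le_add_of_nonneg_right (mul_nonneg (S.gap_nonneg _) (hB.apply_mul_self_nonneg _))

end States

section NodeIntervals

lemma notMem_range_of_mem_Ioo {k : ℕ} {y : ℝ} (hy : y ∈ Ioo (S.node k) (S.node (k + 1))) :
    y ∉ range S.y := by
  rintro ⟨j, rfl⟩
  rw [← node_add_one] at hy
  rcases lt_or_ge (j : ℕ) k with h | h
  · exact absurd hy.1 (S.node_monotone h).not_gt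
  · exact absurd hy.2 (S.node_monotone (Nat.succ_le_succ h)).not_gt

lemma Ioo_node_subset {k : ℕ} (hk : k ≤ n) : Ioo (S.node k) (S.node (k + 1)) ⊆ Ioo (-1) 1 :=
  Ioo_subset_Ioo (S.node_monotone (Nat.zero_le k))
    ((S.node_monotone (Nat.succ_le_succ hk)).trans_eq S.node_last)

lemma exists_mem_Ioo_node {y : ℝ} (hy : y ∈ Ioo (-1) 1) (hyS : y ∉ range S.y) :
    ∃ k ≤ n, y ∈ Ioo (S.node k) (S.node (k + 1)) := by
  classical
  have hlast : y < S.node (n + 1) := S.node_last.symm ▸ hy.2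
  have hex : ∃ k, y < S.node k := ⟨n + 1, hlast⟩
  have hpos : Nat.find hex ≠ 0 := fun h => (h ▸ Nat.find_spec hex).not_gt hy.1
  obtain ⟨k, hk⟩ := Nat.exists_eq_succ_of_ne_zero hpos
  have hgt : y < S.node (k + 1) := by simpa only [hk] using Nat.find_spec hex
  have hle : S.node k ≤ y := not_lt.1 (Nat.find_min hex (by lia))
  have hkn : k ≤ n := Nat.succ_le_succ_iff.1 (hk ▸ Nat.find_min' hex hlast)
  refine ⟨k, hkn, hle.lt_of_ne ?_, hgt⟩
  rintro rfl
  cases k with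
  | zero => exact hy.1.ne rfl
  | succ k => exact hyS ⟨⟨k, by lia⟩, (S.node_succ (by lia)).symm⟩

lemma neg_one_notMem_range : (-1 : ℝ) ∉ range S.y :=
  fun ⟨j, hj⟩ => (S.neg_one_lt_y j).ne hj.symm

lemma one_notMem_range : (1 : ℝ) ∉ range S.y :=
  fun ⟨j, hj⟩ => (S.y_lt_one j).ne hj

end NodeIntervals

namespace IsSolution

variable {S} {lam : ℂ} {Φ Ψ : ℝ → Fin 3 → ℂ}

lemma eq_drift (h : S.IsSolution lam Φ) {k : ℕ} (hk : k ≤ n) {v : Fin 3 → ℂ}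
    (hv : Tendsto Φ (𝓝[>] S.node k) (𝓝 v)) {y : ℝ}
    (hy : y ∈ Ioo (S.node k) (S.node (k + 1))) : Φ y = drift lam (y - S.node k) v := by
  have hmem : ∀ t ∈ Ioo (S.node k) (S.node (k + 1)), t ∈ Ioo (-1 : ℝ) 1 ∧ t ∉ range S.y :=
    fun t ht => ⟨S.Ioo_node_subset hk ht, S.notMem_range_of_mem_Ioo ht⟩
  have hvi := tendsto_pi_nhds.1 hv
  have h₀ : ∀ t ∈ Ioo (S.node k) (S.node (k + 1)), Φ t 0 = v 0 := fun t =>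
    eq_of_hasDerivAt_zero_of_tendsto
      (fun s hs => h.hasDerivAt_one s (hmem s hs).1 (hmem s hs).2) (hvi 0)
  have h₁ : Φ y 1 = v 1 := eq_of_hasDerivAt_zero_of_tendsto
    (fun s hs => h.hasDerivAt_two s (hmem s hs).1 (hmem s hs).2) (hvi 1) hy
  have hderiv : ∀ t ∈ Ioo (S.node k) (S.node (k + 1)),
      HasDerivAt (fun s => Φ s 2 - drift lam (s - S.node k) v 2) 0 t := fun t ht => by
    simpa only [h₀ t ht, sub_self] using
      (h.hasDerivAt_three t (hmem t ht).1 (hmem t ht).2).fun_sub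
        (hasDerivAt_drift_sub_two lam _ v t)
  have hlim : Tendsto (fun s => Φ s 2 - drift lam (s - S.node k) v 2) (𝓝[>] S.node k) (𝓝 0) := by
    simpa only [sub_self, drift_zero_length] using (hvi 2).sub
      ((hasDerivAt_drift_sub_two lam (S.node k) v _).continuousAt.tendsto.mono_left
        nhdsWithin_le_nhds)
  exact funext_fin_three (h₀ y hy) h₁
    (sub_eq_zero.1 (eq_of_hasDerivAt_zero_of_tendsto hderiv hlim hy))

lemma tendsto_drift (h : S.IsSolution lam Φ) {k : ℕ} (hk : k ≤ n) {v : Fin 3 → ℂ}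
    (hv : Tendsto Φ (𝓝[>] S.node k) (𝓝 v)) :
    Tendsto Φ (𝓝[<] S.node (k + 1)) (𝓝 (drift lam (S.gap k) v)) := by
  refine (((continuous_drift_sub lam (S.node k) v).tendsto (S.node (k + 1))).mono_left
    nhdsWithin_le_nhds).congr' ?_
  exact eventually_of_mem (Ioo_mem_nhdsLT (S.node_lt_succ hk))
    fun y hy => (h.eq_drift hk hv hy).symm

lemma tendsto_massJump (h : S.IsSolution lam Φ) (k : Fin n) {v : Fin 3 → ℂ}
    (hv : Tendsto Φ (𝓝[<] S.y k) (𝓝 v)) :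
    Tendsto Φ (𝓝[>] S.y k) (𝓝 (massJump (S.g k) v)) := by
  have hvi := tendsto_pi_nhds.1 hv
  have hcont := (h.continuousAt_three k).tendsto
  obtain ⟨p₁, q₁, p₂, q₂, hp₁, hq₁, hp₂, hq₂, hjump₁, hjump₂⟩ := h.jump k
  obtain rfl : p₁ = v 0 := tendsto_nhds_unique hp₁ (hvi 0)
  obtain rfl : p₂ = v 1 := tendsto_nhds_unique hp₂ (hvi 1)
  have hv₂ : Φ (S.y k) 2 = v 2 :=
    tendsto_nhds_unique (hcont.mono_left nhdsWithin_le_nhds) (hvi 2)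
  rw [hv₂] at hjump₂ hcont
  have hjump : massJump (S.g k) v = ![q₁, q₂, v 2] := by
    refine funext_fin_three ?_ ?_ rfl
    · simp only [massJump_zero, Complex.real_smul, Complex.ofReal_div, Complex.ofReal_ofNat,
        Matrix.cons_val_zero]
      linear_combination -hjump₁ - (S.g k : ℂ) / 2 * hjump₂
    · simp only [massJump_one, Complex.real_smul, Matrix.cons_val_one, Matrix.cons_val_zero]
      linear_combination -hjump₂
  rw [hjump]
  exact tendsto_pi_nhds.2 (Fin.forall_fin_succ.2
    ⟨hq₁, Fin.forall_fin_two.2 ⟨hq₂, hcont.mono_left nhdsWithin_le_nhds⟩⟩)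

lemma tendsto_rightState (h : S.IsSolution lam Φ) {k : ℕ} (hk : k ≤ n) :
    Tendsto Φ (𝓝[>] S.node k) (𝓝 (S.rightState lam (Φ (-1)) k)) := by
  induction k with
  | zero => exact h.continuous_left.tendsto.mono_left (nhdsWithin_mono _ Ioi_subset_Ici_self)
  | succ k ih =>
    have hleft := h.tendsto_drift (k.le_succ.trans hk) (ih (k.le_succ.trans hk))
    have hright := h.tendsto_massJump ⟨k, hk⟩ (S.node_succ hk ▸ hleft)
    rwa [← S.node_succ hk, ← S.mass_coe ⟨k, hk⟩] at hright

lemma apply_one (h : S.IsSolution lam Φ) : Φ 1 = S.leftState lam (Φ (-1)) n := by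
  have hlim := h.tendsto_drift le_rfl (h.tendsto_rightState le_rfl)
  rw [S.node_last] at hlim
  exact tendsto_nhds_unique
    (h.continuous_right.tendsto.mono_left (nhdsWithin_mono _ Iio_subset_Iic_self)) hlim

lemma eq_smul (h : S.IsSolution lam Φ) (h' : S.IsSolution lam Ψ) {a : ℂ}
    (ha : Φ (-1) = a • Ψ (-1)) {y : ℝ} (hy : y ∈ Icc (-1) 1) (hyS : y ∉ range S.y) :
    Φ y = a • Ψ y := by
  rcases hy.1.eq_or_lt with rfl | hgt
  · exact ha
  rcases hy.2.eq_or_lt with rfl | hlt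
  · rw [h.apply_one, h'.apply_one, ha, leftState, leftState, rightState_smul, drift_smul]
  obtain ⟨k, hk, hyk⟩ := S.exists_mem_Ioo_node ⟨hgt, hlt⟩ hyS
  rw [h.eq_drift hk (h.tendsto_rightState hk) hyk, h'.eq_drift hk (h'.tendsto_rightState hk) hyk,
    ha, rightState_smul, drift_smul]

end IsSolution

section Existence

/-- The number `k` of the interval between the nodes `k` and `k + 1` that contains `y`, including
its right end point; it is `0` for `y ≤ -1`. -/
noncomputable def interval (y : ℝ) : ℕ := sInf {k | y ≤ S.node (k + 1)}

lemma interval_eq {k : ℕ} {y : ℝ} (hy : y ≤ S.node (k + 1)) (hk : k = 0 ∨ S.node k < y) :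
    S.interval y = k := by
  refine le_antisymm (Nat.sInf_le hy) ?_
  by_contra! hlt
  have hmem : S.interval y ∈ {k | y ≤ S.node (k + 1)} := Nat.sInf_mem ⟨k, hy⟩
  rcases hk with rfl | hk
  · exact absurd hlt (Nat.not_lt_zero _)
  · exact absurd hk (hmem.trans (S.node_monotone hlt)).not_gt

/-- The solution with initial value `v`, in closed form. -/
noncomputable def explicitSolution (lam : ℂ) (v : Fin 3 → ℂ) (y : ℝ) : Fin 3 → ℂ :=
  drift lam (y - S.node (S.interval y)) (S.rightState lam v (S.interval y))

variable (lam : ℂ) (v : Fin 3 → ℂ)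

lemma explicitSolution_neg_one : S.explicitSolution lam v (-1) = v := by
  have hinterval : S.interval (-1) = 0 :=
    S.interval_eq (S.node_monotone (Nat.zero_le 1)) (.inl rfl)
  rw [explicitSolution, hinterval, node_zero, sub_self, drift_zero_length, rightState_zero]

lemma explicitSolution_eq_of_mem_Ioc {k : ℕ} {y : ℝ}
    (hy : y ∈ Ioc (S.node k) (S.node (k + 1))) :
    S.explicitSolution lam v y = drift lam (y - S.node k) (S.rightState lam v k) := by
  rw [explicitSolution, S.interval_eq hy.2 (.inr hy.1)]

lemma explicitSolution_node_succ {k : ℕ} (hk : k ≤ n) :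
    S.explicitSolution lam v (S.node (k + 1)) = S.leftState lam v k :=
  S.explicitSolution_eq_of_mem_Ioc lam v ⟨S.node_lt_succ hk, le_rfl⟩

lemma explicitSolution_y (k : Fin n) :
    S.explicitSolution lam v (S.y k) = S.leftState lam v k := by
  rw [← node_add_one, S.explicitSolution_node_succ lam v k.2.le]

lemma exists_explicitSolution_eventuallyEq {y : ℝ} (hy : y ∈ Ioo (-1) 1) (hyS : y ∉ range S.y) :
    ∃ k, S.explicitSolution lam v =ᶠ[𝓝 y]
      fun t => drift lam (t - S.node k) (S.rightState lam v k) := by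
  obtain ⟨k, -, hyk⟩ := S.exists_mem_Ioo_node hy hyS
  exact ⟨k, eventually_of_mem (isOpen_Ioo.mem_nhds hyk) fun t ht =>
    S.explicitSolution_eq_of_mem_Ioc lam v (Ioo_subset_Ioc_self ht)⟩

lemma explicitSolution_tendsto_nhdsLE {k : ℕ} (hk : k ≤ n) :
    Tendsto (S.explicitSolution lam v) (𝓝[≤] S.node (k + 1)) (𝓝 (S.leftState lam v k)) := by
  refine (((continuous_drift_sub lam (S.node k) _).tendsto (S.node (k + 1))).mono_left
    nhdsWithin_le_nhds).congr' ?_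
  exact eventually_of_mem (Ioc_mem_nhdsLE (S.node_lt_succ hk)) fun t ht =>
    (S.explicitSolution_eq_of_mem_Ioc lam v ht).symm

lemma explicitSolution_tendsto_nhdsGT {k : ℕ} (hk : k ≤ n) :
    Tendsto (S.explicitSolution lam v) (𝓝[>] S.node k) (𝓝 (S.rightState lam v k)) := by
  have hlim := ((continuous_drift_sub lam (S.node k) (S.rightState lam v k)).tendsto
    (S.node k)).mono_left (nhdsWithin_le_nhds (s := Ioi (S.node k)))
  rw [sub_self, drift_zero_length] at hlim
  refine hlim.congr' ?_
  exact eventually_of_mem (Ioc_mem_nhdsGT (S.node_lt_succ hk)) fun t ht =>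
    (S.explicitSolution_eq_of_mem_Ioc lam v ht).symm

lemma explicitSolution_tendsto_nhdsLT_y (k : Fin n) :
    Tendsto (S.explicitSolution lam v) (𝓝[<] S.y k) (𝓝 (S.leftState lam v k)) := by
  rw [← node_add_one]
  exact (S.explicitSolution_tendsto_nhdsLE lam v k.2.le).mono_left
    (nhdsWithin_mono _ Iio_subset_Iic_self)

lemma explicitSolution_tendsto_nhdsGT_y (k : Fin n) :
    Tendsto (S.explicitSolution lam v) (𝓝[>] S.y k)
      (𝓝 (massJump (S.g k) (S.leftState lam v k))) := by
  rw [← node_add_one, ← mass_coe]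
  exact S.explicitSolution_tendsto_nhdsGT lam v k.2

lemma isSolution_explicitSolution : S.IsSolution lam (S.explicitSolution lam v) where
  hasDerivAt_one y hy hyS := by
    obtain ⟨k, hk⟩ := S.exists_explicitSolution_eventuallyEq lam v hy hyS
    exact (hasDerivAt_const y (S.rightState lam v k 0)).congr_of_eventuallyEq
      (hk.mono fun t ht => congrFun ht 0)
  hasDerivAt_two y hy hyS := by
    obtain ⟨k, hk⟩ := S.exists_explicitSolution_eventuallyEq lam v hy hyS
    exact (hasDerivAt_const y (S.rightState lam v k 1)).congr_of_eventuallyEq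
      (hk.mono fun t ht => congrFun ht 1)
  hasDerivAt_three y hy hyS := by
    obtain ⟨k, hk⟩ := S.exists_explicitSolution_eventuallyEq lam v hy hyS
    rw [hk.self_of_nhds]
    exact (hasDerivAt_drift_sub_two lam (S.node k) (S.rightState lam v k) y).congr_of_eventuallyEq
      (hk.mono fun t ht => congrFun ht 2)
  continuousAt_three k := by
    rw [continuousAt_iff_continuous_left'_right', ContinuousWithinAt, ContinuousWithinAt,
      explicitSolution_y]
    exact ⟨tendsto_pi_nhds.1 (S.explicitSolution_tendsto_nhdsLT_y lam v k) 2,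
      tendsto_pi_nhds.1 (S.explicitSolution_tendsto_nhdsGT_y lam v k) 2⟩
  jump k := by
    have hleft := tendsto_pi_nhds.1 (S.explicitSolution_tendsto_nhdsLT_y lam v k)
    have hright := tendsto_pi_nhds.1 (S.explicitSolution_tendsto_nhdsGT_y lam v k)
    refine ⟨_, _, _, _, hleft 0, hright 0, hleft 1, hright 1, ?_, ?_⟩
    · simp only [massJump_zero, massJump_one, Complex.real_smul]
      push_cast
      ring
    · rw [explicitSolution_y, massJump_one, Complex.real_smul, add_sub_cancel_left]
  continuous_left := by
    rw [← continuousWithinAt_Ioi_iff_Ici, ContinuousWithinAt, explicitSolution_neg_one]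
    exact S.explicitSolution_tendsto_nhdsGT lam v (Nat.zero_le n)
  continuous_right := by
    have hlim := S.explicitSolution_tendsto_nhdsLE lam v le_rfl
    rwa [← S.explicitSolution_node_succ lam v le_rfl, S.node_last] at hlim

lemma isNormalizedSolution_phi : S.IsNormalizedSolution lam (S.phi lam) :=
  Classical.epsilon_spec ⟨_, S.isSolution_explicitSolution lam ![1, 0, 0],
    S.explicitSolution_neg_one lam _⟩

end Existence

section Eigenfunctions

variable {S} {lam : ℂ} {Φ : ℝ → Fin 3 → ℂ}

lemma IsNormalizedSolution.eq_phi (h : S.IsNormalizedSolution lam Φ) {y : ℝ}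
    (hy : y ∈ Icc (-1) 1) (hyS : y ∉ range S.y) : Φ y = S.phi lam y := by
  rw [h.1.eq_smul (S.isNormalizedSolution_phi lam).1 (a := 1) _ hy hyS, one_smul]
  rw [h.2, (S.isNormalizedSolution_phi lam).2, one_smul]

lemma IsEigenfunction.eq_smul_phi (h : S.IsEigenfunction lam Φ) {y : ℝ} (hy : y ∈ Icc (-1) 1)
    (hyS : y ∉ range S.y) : Φ y = Φ (-1) 0 • S.phi lam y := by
  refine h.1.eq_smul (S.isNormalizedSolution_phi lam).1 ?_ hy hyS
  rw [(S.isNormalizedSolution_phi lam).2]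
  exact funext_fin_three (by simp) (by simpa using h.2.1) (by simpa using h.2.2.1)

lemma phi_one (S : DualCubicString n) (lam : ℂ) :
    S.phi lam 1 = S.leftState lam ![1, 0, 0] n := by
  rw [(S.isNormalizedSolution_phi lam).1.apply_one, (S.isNormalizedSolution_phi lam).2]

lemma mem_spectrum_iff : lam ∈ S.spectrum ↔ S.phi lam 1 2 = 0 := by
  constructor
  · rintro ⟨Φ, hΦ⟩
    have hend : Φ 1 = Φ (-1) 0 • S.phi lam 1 :=
      hΦ.eq_smul_phi (right_mem_Icc.2 (neg_le_self zero_le_one)) S.one_notMem_range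
    obtain ⟨y, hy, hyS, hne⟩ := hΦ.2.2.2.2
    refine (mul_eq_zero.1 ((congrFun hend 2).symm.trans hΦ.2.2.2.1)).resolve_left fun h0 => ?_
    exact hne (by rw [hΦ.eq_smul_phi hy hyS, h0, zero_smul])
  · intro h
    obtain ⟨hsol, hinit⟩ := S.isNormalizedSolution_phi lam
    refine ⟨S.phi lam, hsol, congrFun hinit 1, congrFun hinit 2, h, -1,
      left_mem_Icc.2 (neg_le_self zero_le_one), S.neg_one_notMem_range, fun h0 => ?_⟩
    exact one_ne_zero (congrFun (hinit.symm.trans h0) 0)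

end Eigenfunctions

section EndPolynomials

lemma aeval_leftState {R : Type*} [CommRing R] [Algebra ℝ R] (lam : R) (k : ℕ) (i : Fin 3) :
    aeval lam (S.leftState (X : ℝ[X]) ![1, 0, 0] k i) = S.leftState lam ![1, 0, 0] k i := by
  have hinit : aeval lam ∘ (![1, 0, 0] : Fin 3 → ℝ[X]) = ![1, 0, 0] :=
    funext_fin_three (map_one _) (map_zero _) (map_zero _)
  rw [← Function.comp_apply (f := aeval lam), map_comp_leftState, hinit, aeval_X]

lemma eval_leftState (t : ℝ) (k : ℕ) (i : Fin 3) :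
    (S.leftState (X : ℝ[X]) ![1, 0, 0] k i).eval t = S.leftState t ![1, 0, 0] k i := by
  rw [← S.aeval_leftState t k i, coe_aeval_eq_eval]

/-- The component `i` of the end value `Φ(1; lam)` as a polynomial in `lam`. -/
noncomputable def endPoly (i : Fin 3) : ℝ[X] := S.leftState X ![1, 0, 0] n i

lemma phi_one_apply (lam : ℂ) (i : Fin 3) : S.phi lam 1 i = aeval lam (S.endPoly i) := by
  rw [phi_one, endPoly, aeval_leftState]

lemma hasDerivAt_phi_one (lam : ℂ) (i : Fin 3) :
    HasDerivAt (fun lam => S.phi lam 1 i) (aeval lam (derivative (S.endPoly i))) lam := by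
  simpa only [phi_one_apply] using (S.endPoly i).hasDerivAt_aeval lam

lemma mem_spectrum_iff_aeval_eq_zero {lam : ℂ} :
    lam ∈ S.spectrum ↔ aeval lam (S.endPoly 2) = 0 := by
  rw [mem_spectrum_iff, phi_one_apply]

lemma aeval_endPoly_pairing_neg {R : Type*} [CommRing R] [Algebra ℝ R] (lam : R) :
    aeval lam (S.endPoly 0) * aeval (-lam) (S.endPoly 2) -
      aeval lam (S.endPoly 1) * aeval (-lam) (S.endPoly 1) +
      aeval lam (S.endPoly 2) * aeval (-lam) (S.endPoly 0) = 0 := by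
  have h := S.statePairing_leftState_neg lam ![1, 0, 0] ![1, 0, 0] n
  simpa [statePairing, endPoly, aeval_leftState] using h

lemma im_eq_zero_of_aeval_endPoly_two_eq_zero (hg : ∀ k, 0 ≤ S.g k) {z : ℂ}
    (hz : aeval z (S.endPoly 2) = 0) : z.im = 0 := by
  have hle := S.gap_zero_mul_apply_le_apply_leftState hg (isSpectralForm_im_smul_areaForm z) n
  rw [← aeval_leftState, ← endPoly, hz] at hle
  have hsq : S.gap 0 * z.im ^ 2 ≤ 0 := by simpa [Complex.areaForm, sq] using hle
  have hgap := S.gap_pos (Nat.zero_le n)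
  exact pow_eq_zero_iff two_ne_zero |>.1 (le_antisymm (by nlinarith) (sq_nonneg _))

lemma wronskian_endPoly_pos (hg : ∀ k, 0 ≤ S.g k) (t : ℝ) :
    0 < (wronskian (S.endPoly 2) (S.endPoly 0)).eval t := by
  have hle := S.gap_zero_mul_apply_le_apply_leftState hg (isSpectralForm_wronskianBilin t) n
  have hone : wronskian (1 : ℝ[X]) X = 1 := by simp [wronskian]
  refine (S.gap_pos (Nat.zero_le n)).trans_le ?_
  simpa [hone, endPoly] using hle

lemma derivative_endPoly_two_mul_endPoly_zero_neg (hg : ∀ k, 0 ≤ S.g k) {t : ℝ}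
    (ht : (S.endPoly 2).eval t = 0) :
    (derivative (S.endPoly 2)).eval t * (S.endPoly 0).eval t < 0 := by
  simpa [wronskian, ht] using S.wronskian_endPoly_pos hg t

lemma derivative_endPoly_two_ne_zero (hg : ∀ k, 0 ≤ S.g k) {t : ℝ}
    (ht : (S.endPoly 2).eval t = 0) : (derivative (S.endPoly 2)).eval t ≠ 0 :=
  left_ne_zero_of_mul (S.derivative_endPoly_two_mul_endPoly_zero_neg hg ht).ne

lemma leftState_pos (hg : ∀ k, 0 ≤ S.g k) {t : ℝ} (ht : t < 0) (k : ℕ) :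
    0 < S.leftState t ![1, 0, 0] k 0 ∧ 0 ≤ S.leftState t ![1, 0, 0] k 1 ∧
      0 < S.leftState t ![1, 0, 0] k 2 := by
  induction k with
  | zero => simpa [leftState, rightState_zero] using mul_neg_of_pos_of_neg (S.gap_pos n.zero_le) ht
  | succ k ih =>
    obtain ⟨h₀, h₁, h₂⟩ := ih
    have hmass := S.mass_nonneg hg k
    have hzero : 0 < S.leftState t ![1, 0, 0] (k + 1) 0 := by
      rw [leftState_succ_zero, smul_eq_mul, smul_eq_mul]
      positivity
    refine ⟨hzero, ?_, ?_⟩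
    · rw [leftState_succ_one, smul_eq_mul]
      positivity
    · rw [leftState_succ_two, smul_eq_mul, sub_pos]
      exact (mul_nonpos_of_nonneg_of_nonpos (S.gap_nonneg _)
        (mul_neg_of_neg_of_pos ht hzero).le).trans_lt h₂

lemma leftState_zero_param {R : Type*} [CommRing R] [Algebra ℝ R] (k : ℕ) :
    S.leftState (0 : R) ![1, 0, 0] k = ![1, 0, 0] := by
  induction k with
  | zero => exact funext_fin_three rfl rfl (by simp [leftState, rightState_zero])
  | succ k ih =>
    have hzero : S.leftState (0 : R) ![1, 0, 0] (k + 1) 0 = 1 := by simp [leftState_succ_zero, ih]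
    exact funext_fin_three hzero (by simp [leftState_succ_one, ih])
      (by simp [leftState_succ_two, ih])

lemma eval_zero_endPoly (i : Fin 3) : (S.endPoly i).eval 0 = ![1, 0, 0] i := by
  rw [endPoly, eval_leftState, leftState_zero_param]

lemma eval_zero_derivative_leftState_two (k : ℕ) :
    (derivative (S.leftState (X : ℝ[X]) ![1, 0, 0] k 2)).eval 0 = -(S.node (k + 1) + 1) := by
  induction k with
  | zero => simp [leftState, rightState_zero, gap, node_zero]
  | succ k ih =>
    have hzero : (S.leftState (X : ℝ[X]) ![1, 0, 0] (k + 1) 0).eval 0 = 1 := by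
      rw [eval_leftState, leftState_zero_param]
      rfl
    simp only [leftState_succ_two, derivative_sub, derivative_smul, derivative_mul, derivative_X,
      eval_sub, eval_smul, eval_add, eval_mul, eval_X, eval_one, hzero, ih, gap, smul_eq_mul]
    ring

lemma eval_zero_derivative_endPoly_two : (derivative (S.endPoly 2)).eval 0 = -2 := by
  rw [endPoly, eval_zero_derivative_leftState_two, node_last, one_add_one_eq_two]

lemma natDegree_leftState_le (k : ℕ) :
    (S.leftState (X : ℝ[X]) ![1, 0, 0] k 0).natDegree ≤ k ∧
      (S.leftState (X : ℝ[X]) ![1, 0, 0] k 1).natDegree ≤ k ∧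
      (S.leftState (X : ℝ[X]) ![1, 0, 0] k 2).natDegree ≤ k + 1 := by
  induction k with
  | zero =>
    refine ⟨by simp [leftState, rightState_zero], by simp [leftState, rightState_zero], ?_⟩
    simpa [leftState, rightState_zero] using (natDegree_smul_le (S.gap 0) X).trans natDegree_X_le
  | succ k ih =>
    obtain ⟨h₀, h₁, h₂⟩ := ih
    have hsmul {m : ℕ} {p : ℝ[X]} (a : ℝ) (hp : p.natDegree ≤ m) : (a • p).natDegree ≤ m :=
      (natDegree_smul_le a p).trans hp
    have hzero : (S.leftState (X : ℝ[X]) ![1, 0, 0] (k + 1) 0).natDegree ≤ k + 1 :=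
      natDegree_add_le_of_degree_le (h₀.trans k.le_succ)
        (hsmul _ (natDegree_add_le_of_degree_le (h₁.trans k.le_succ) (hsmul _ h₂)))
    refine ⟨hzero, natDegree_add_le_of_degree_le (h₁.trans k.le_succ) (hsmul _ h₂), ?_⟩
    have hX : (X * S.leftState (X : ℝ[X]) ![1, 0, 0] (k + 1) 0).natDegree ≤ k + 2 :=
      (natDegree_mul_le_of_le natDegree_X_le hzero).trans_eq (Nat.add_comm _ _)
    exact natDegree_sub_le_of_le (h₂.trans (k + 1).le_succ) (hsmul _ hX) |>.trans_eq (max_self _)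

lemma coeff_leftState_two_ne_zero (hg : ∀ k, S.g k ≠ 0) {k : ℕ} (hk : k ≤ n) :
    (S.leftState (X : ℝ[X]) ![1, 0, 0] k 2).coeff (k + 1) ≠ 0 := by
  induction k with
  | zero => simpa [leftState, rightState_zero, coeff_one] using (S.gap_pos n.zero_le).ne'
  | succ k ih =>
    obtain ⟨h₀, h₁, h₂⟩ := S.natDegree_leftState_le k
    have hcoeff : (S.leftState (X : ℝ[X]) ![1, 0, 0] (k + 1) 2).coeff (k + 2) =
        -(S.gap (k + 1) * (S.mass k ^ 2 / 2)) *
          (S.leftState (X : ℝ[X]) ![1, 0, 0] k 2).coeff (k + 1) := by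
      simp only [leftState_succ_two, leftState_succ_zero, coeff_sub, coeff_smul, coeff_X_mul,
        coeff_add, smul_eq_mul, coeff_eq_zero_of_natDegree_lt (Nat.lt_succ_of_le h₀),
        coeff_eq_zero_of_natDegree_lt (Nat.lt_succ_of_le h₁),
        coeff_eq_zero_of_natDegree_lt (Nat.lt_succ_of_le h₂)]
      ring
    rw [hcoeff]
    have hgap := (S.gap_pos hk).ne'
    have hmass := S.mass_ne_zero hg hk
    exact mul_ne_zero (neg_ne_zero.2 (by positivity)) (ih (Nat.le_of_succ_le hk))

lemma natDegree_endPoly_le {i : Fin 3} (hi : i ≠ 2) : (S.endPoly i).natDegree ≤ n := by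
  obtain ⟨h₀, h₁, -⟩ := S.natDegree_leftState_le n
  fin_cases i
  exacts [h₀, h₁, (hi rfl).elim]

lemma natDegree_endPoly_two (hg : ∀ k, S.g k ≠ 0) : (S.endPoly 2).natDegree = n + 1 :=
  natDegree_eq_of_le_of_coeff_ne_zero (S.natDegree_leftState_le n).2.2
    (S.coeff_leftState_two_ne_zero hg le_rfl)

lemma degree_endPoly_lt_degree_endPoly_two (hg : ∀ k, S.g k ≠ 0) {i : Fin 3} (hi : i ≠ 2) :
    (S.endPoly i).degree < (S.endPoly 2).degree :=
  degree_lt_degree <| by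
    rw [S.natDegree_endPoly_two hg]
    exact Nat.lt_succ_of_le (S.natDegree_endPoly_le hi)

end EndPolynomials

section Spectrum

lemma endPoly_two_ne_zero : S.endPoly 2 ≠ 0 := fun h => by
  have := S.eval_zero_derivative_endPoly_two
  simp [h] at this

lemma splits_endPoly_two (hg : ∀ k, 0 ≤ S.g k) : (S.endPoly 2).Splits :=
  splits_of_forall_im_eq_zero fun _ => S.im_eq_zero_of_aeval_endPoly_two_eq_zero hg

lemma nodup_roots_endPoly_two (hg : ∀ k, 0 ≤ S.g k) : (S.endPoly 2).roots.Nodup := by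
  refine Multiset.nodup_iff_count_le_one.2 fun t => ?_
  rw [count_roots]
  by_contra! hmult
  obtain ⟨hroot, hderiv⟩ := (one_lt_rootMultiplicity_iff_isRoot S.endPoly_two_ne_zero).1 hmult
  exact S.derivative_endPoly_two_ne_zero hg hroot hderiv

lemma card_roots_endPoly_two (hg : ∀ k, 0 < S.g k) :
    (S.endPoly 2).roots.toFinset.card = n + 1 := by
  rw [Multiset.toFinset_card_of_nodup (S.nodup_roots_endPoly_two fun k => (hg k).le),
    ← (S.splits_endPoly_two fun k => (hg k).le).natDegree_eq_card_roots,
    S.natDegree_endPoly_two fun k => (hg k).ne']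

/-- The eigenvalues `λ₀ < λ₁ < ⋯ < λₙ` of the string, listed as the zeros of `φ₃(1; ·)`. -/
noncomputable def eigenvalue (hg : ∀ k, 0 < S.g k) : Fin (n + 1) ↪o ℝ :=
  (S.endPoly 2).roots.toFinset.orderEmbOfFin (S.card_roots_endPoly_two hg)

variable (hg : ∀ k, 0 < S.g k)

lemma range_eigenvalue : range (S.eigenvalue hg) = {t | (S.endPoly 2).eval t = 0} := by
  ext t
  simp [eigenvalue, S.endPoly_two_ne_zero]

lemma eval_endPoly_two_eigenvalue (j : Fin (n + 1)) :
    (S.endPoly 2).eval (S.eigenvalue hg j) = 0 :=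
  (S.range_eigenvalue hg).subset (mem_range_self j)

lemma eigenvalue_zero : S.eigenvalue hg 0 = 0 := by
  obtain ⟨j, hj⟩ : (0 : ℝ) ∈ range (S.eigenvalue hg) := by
    rw [range_eigenvalue]
    exact S.eval_zero_endPoly 2
  refine le_antisymm (((S.eigenvalue hg).monotone (Fin.zero_le j)).trans_eq hj) ?_
  by_contra! hneg
  have hpos := (S.leftState_pos (fun k => (hg k).le) hneg n).2.2
  rw [← eval_leftState, ← endPoly, eval_endPoly_two_eigenvalue] at hpos
  exact hpos.false

lemma eigenvalue_succ_pos (k : Fin n) : 0 < S.eigenvalue hg k.succ :=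
  (S.eigenvalue_zero hg).symm.trans_lt ((S.eigenvalue hg).strictMono k.succ_pos)

lemma spectrum_eq_range : S.spectrum = range fun j => (S.eigenvalue hg j : ℂ) := by
  ext lam
  rw [mem_spectrum_iff_aeval_eq_zero, range_comp' Complex.ofReal, range_eigenvalue]
  constructor
  · intro hlam
    have him := S.im_eq_zero_of_aeval_endPoly_two_eq_zero (fun k => (hg k).le) hlam
    have hre : lam = (lam.re : ℂ) := Complex.ext rfl him
    refine ⟨lam.re, ?_, hre.symm⟩
    rwa [hre, ← Complex.coe_algebraMap, aeval_algebraMap_apply_eq_algebraMap_eval,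
      map_eq_zero] at hlam
  · rintro ⟨t, ht, rfl⟩
    rw [← Complex.coe_algebraMap, aeval_algebraMap_apply_eq_algebraMap_eval, ht, map_zero]

lemma phi_eigenvalue_one_two (j : Fin (n + 1)) : S.phi (S.eigenvalue hg j) 1 2 = 0 := by
  rw [← mem_spectrum_iff, S.spectrum_eq_range hg]
  exact mem_range_self j

lemma deriv_phi_eigenvalue_one_two_ne_zero (j : Fin (n + 1)) :
    deriv (fun lam => S.phi lam 1 2) (S.eigenvalue hg j : ℂ) ≠ 0 := by
  rw [(S.hasDerivAt_phi_one _ 2).deriv, ← Complex.coe_algebraMap,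
    aeval_algebraMap_apply_eq_algebraMap_eval]
  exact Complex.ofReal_ne_zero.2 (S.derivative_endPoly_two_ne_zero (fun k => (hg k).le)
    (S.eval_endPoly_two_eigenvalue hg j))

end Spectrum

section WeylFunctions

/-- The residue of `-φᵢ(1; ·) / φ₃(1; ·)` at a simple zero `t` of `φ₃(1; ·)`. -/
noncomputable def residue (i : Fin 3) (t : ℝ) : ℝ :=
  -((S.endPoly i).eval t / (derivative (S.endPoly 2)).eval t)

lemma neg_aeval_endPoly_div_eq_sum (hg : ∀ k, 0 < S.g k) {i : Fin 3} (hi : i ≠ 2) {L : Type*}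
    [Field L] [Algebra ℝ L] {x : L} (hx : aeval x (S.endPoly 2) ≠ 0) :
    -(aeval x (S.endPoly i) / aeval x (S.endPoly 2)) = ∑ j : Fin (n + 1),
      algebraMap ℝ L (S.residue i (S.eigenvalue hg j)) /
        (x - algebraMap ℝ L (S.eigenvalue hg j)) := by
  rw [aeval_div_aeval_eq_sum_roots (S.splits_endPoly_two fun k => (hg k).le)
    (S.nodup_roots_endPoly_two fun k => (hg k).le)
    (S.degree_endPoly_lt_degree_endPoly_two (fun k => (hg k).ne') hi) hx,
    ← Finset.sum_neg_distrib, ← Finset.map_orderEmbOfFin_univ _ (S.card_roots_endPoly_two hg),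
    Finset.sum_map]
  exact Finset.sum_congr rfl fun j _ => by rw [residue, map_neg, neg_div]; rfl

lemma residue_zero_zero : S.residue 0 0 = 1 / 2 := by
  rw [residue, eval_zero_endPoly, eval_zero_derivative_endPoly_two]
  norm_num

lemma residue_one_zero : S.residue 1 0 = 0 := by
  rw [residue, eval_zero_endPoly]
  simp

lemma residue_zero_pos (hg : ∀ k, 0 ≤ S.g k) {t : ℝ} (ht : (S.endPoly 2).eval t = 0) :
    0 < S.residue 0 t := by
  have h := mul_neg_iff.1 (S.derivative_endPoly_two_mul_endPoly_zero_neg hg ht)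
  exact neg_pos.2 (div_neg_iff.2 (by tauto))

lemma neg_aeval_endPoly_one_div_eq_sum (hg : ∀ k, 0 < S.g k) {L : Type*} [Field L] [Algebra ℝ L]
    {x : L} (hx : aeval x (S.endPoly 2) ≠ 0) :
    -(aeval x (S.endPoly 1) / aeval x (S.endPoly 2)) = ∑ k : Fin n,
      algebraMap ℝ L (S.residue 1 (S.eigenvalue hg k.succ)) /
        (x - algebraMap ℝ L (S.eigenvalue hg k.succ)) := by
  rw [S.neg_aeval_endPoly_div_eq_sum hg (by decide) hx, Fin.sum_univ_succ, eigenvalue_zero,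
    residue_one_zero, map_zero, zero_div, zero_add]

lemma residue_zero_mul_eval_neg {t : ℝ} (ht : (S.endPoly 2).eval t = 0) :
    S.residue 0 t * (S.endPoly 2).eval (-t) = S.residue 1 t * (S.endPoly 1).eval (-t) := by
  have h := S.aeval_endPoly_pairing_neg t
  simp only [coe_aeval_eq_eval, ht, zero_mul, add_zero, sub_eq_zero] at h
  rw [residue, residue, neg_mul, neg_mul, div_mul_eq_mul_div, div_mul_eq_mul_div, h]

lemma residue_one_pos (hg : ∀ k, 0 ≤ S.g k) {t : ℝ} (hpos : 0 < t)
    (ht : (S.endPoly 2).eval t = 0) : 0 < S.residue 1 t := by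
  obtain ⟨-, h₁, h₂⟩ := S.leftState_pos hg (neg_lt_zero.2 hpos) n
  rw [← eval_leftState, ← endPoly] at h₁ h₂
  refine pos_of_mul_pos_left ?_ h₁
  rw [← S.residue_zero_mul_eval_neg ht]
  exact mul_pos (S.residue_zero_pos hg ht) h₂

lemma residue_zero_eq_sum (hg : ∀ k, 0 < S.g k) (k : Fin n) :
    S.residue 0 (S.eigenvalue hg k.succ) = ∑ m : Fin n,
      S.residue 1 (S.eigenvalue hg m.succ) * S.residue 1 (S.eigenvalue hg k.succ) /
        (S.eigenvalue hg m.succ + S.eigenvalue hg k.succ) := by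
  set t := S.eigenvalue hg k.succ
  have hpos : 0 < (S.endPoly 2).eval (-t) := by
    rw [endPoly, eval_leftState]
    exact (S.leftState_pos (fun k => (hg k).le) (neg_lt_zero.2 (S.eigenvalue_succ_pos hg k)) n).2.2
  have hW := S.neg_aeval_endPoly_one_div_eq_sum hg (x := -t) (by simpa using hpos.ne')
  simp only [coe_aeval_eq_eval, Algebra.algebraMap_self, RingHom.id_apply] at hW
  calc
    S.residue 0 t = S.residue 1 t * ((S.endPoly 1).eval (-t) / (S.endPoly 2).eval (-t)) := by
      rw [← mul_div_assoc, eq_div_iff hpos.ne',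
        S.residue_zero_mul_eval_neg (S.eval_endPoly_two_eigenvalue hg _)]
    _ = S.residue 1 t * -∑ m : Fin n, S.residue 1 (S.eigenvalue hg m.succ) /
          (-t - S.eigenvalue hg m.succ) := by rw [← hW, neg_neg]
    _ = _ := by
      rw [← Finset.sum_neg_distrib, Finset.mul_sum]
      refine Finset.sum_congr rfl fun m _ => ?_
      rw [← neg_add', div_neg, neg_neg, add_comm t, ← mul_div_assoc, mul_comm]

lemma weylW_eq_sum (hg : ∀ k, 0 < S.g k) {lam : ℂ} (hlam : lam ∉ S.spectrum) :
    S.weylW lam =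
      ∑ k : Fin n, (S.residue 1 (S.eigenvalue hg k.succ) : ℂ) / (lam - S.eigenvalue hg k.succ) := by
  rw [mem_spectrum_iff_aeval_eq_zero] at hlam
  rw [weylW, phi_one_apply, phi_one_apply, S.neg_aeval_endPoly_one_div_eq_sum hg hlam]
  rfl

lemma weylZ_eq_sum (hg : ∀ k, 0 < S.g k) {lam : ℂ} (hlam : lam ∉ S.spectrum) :
    S.weylZ lam = 1 / (2 * lam) +
      ∑ k : Fin n, (S.residue 0 (S.eigenvalue hg k.succ) : ℂ) / (lam - S.eigenvalue hg k.succ) := by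
  rw [mem_spectrum_iff_aeval_eq_zero] at hlam
  rw [weylZ, phi_one_apply, phi_one_apply, S.neg_aeval_endPoly_div_eq_sum hg (by decide) hlam,
    Fin.sum_univ_succ, eigenvalue_zero, residue_zero_zero, map_zero, sub_zero, map_div₀, map_one,
    map_ofNat, div_div]
  rfl

lemma weylZ_add_weylZ_neg {lam : ℂ} (hlam : lam ∉ S.spectrum) (hneg : -lam ∉ S.spectrum) :
    S.weylZ lam + S.weylZ (-lam) + S.weylW lam * S.weylW (-lam) = 0 := by
  rw [mem_spectrum_iff_aeval_eq_zero] at hlam hneg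
  simp only [weylZ, weylW, phi_one_apply]
  field_simp
  linear_combination -S.aeval_endPoly_pairing_neg lam

end WeylFunctions

section Uniqueness

variable {n' : ℕ} {S' : DualCubicString n'}

/-- The coefficients, indexed by their poles, of the partial fraction expansion of the part of `Z`
that is regular at `0`. -/
noncomputable def residuesZ (hg : ∀ k, 0 < S.g k) : ℂ →₀ ℂ :=
  ∑ k : Fin n,
    Finsupp.single (S.eigenvalue hg k.succ : ℂ) (S.residue 0 (S.eigenvalue hg k.succ) : ℂ)

lemma residuesZ_mem_supported (hg : ∀ k, 0 < S.g k) :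
    S.residuesZ hg ∈ Finsupp.supported ℂ ℂ {a : ℂ | 0 < a.re} :=
  sum_mem fun k _ => Finsupp.single_mem_supported ℂ _ (S.eigenvalue_succ_pos hg k)

lemma weylZ_eq_add_simplePoleSum (hg : ∀ k, 0 < S.g k) {lam : ℂ} (hlam : lam ∉ S.spectrum) :
    S.weylZ lam = 1 / (2 * lam) + simplePoleSum lam (S.residuesZ hg) := by
  rw [S.weylZ_eq_sum hg hlam]
  simp only [residuesZ, map_sum, simplePoleSum_single]

lemma eventually_notMem_spectrum (hg : ∀ k, 0 < S.g k) :
    ∀ᶠ lam in cofinite, lam ∉ S.spectrum ∧ -lam ∉ S.spectrum := by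
  have hfin : S.spectrum.Finite := S.spectrum_eq_range hg ▸ finite_range _
  exact hfin.eventually_cofinite_notMem.and
    (hfin.preimage neg_injective.injOn).eventually_cofinite_notMem

lemma weylZ_eq_of_weylW_eq (hg : ∀ k, 0 < S.g k) (hg' : ∀ k, 0 < S'.g k)
    (hW : ∀ lam, lam ∉ S.spectrum → lam ∉ S'.spectrum → S.weylW lam = S'.weylW lam) {lam : ℂ}
    (hlam : lam ∉ S.spectrum) (hlam' : lam ∉ S'.spectrum) : S.weylZ lam = S'.weylZ lam := by
  suffices hres : S.residuesZ hg - S'.residuesZ hg' = 0 by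
    rw [S.weylZ_eq_add_simplePoleSum hg hlam, S'.weylZ_eq_add_simplePoleSum hg' hlam',
      sub_eq_zero.1 hres]
  apply eq_zero_of_simplePoleSum_odd
  · filter_upwards [S.eventually_notMem_spectrum hg, S'.eventually_notMem_spectrum hg']
      with x ⟨hx, hneg⟩ ⟨hx', hneg'⟩
    have hZ := S.weylZ_add_weylZ_neg hx hneg
    have hZ' := S'.weylZ_add_weylZ_neg hx' hneg'
    rw [S.weylZ_eq_add_simplePoleSum hg hx, S.weylZ_eq_add_simplePoleSum hg hneg] at hZ
    rw [S'.weylZ_eq_add_simplePoleSum hg' hx', S'.weylZ_eq_add_simplePoleSum hg' hneg',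
      ← hW x hx hx', ← hW (-x) hneg hneg'] at hZ'
    rw [map_sub, map_sub]
    linear_combination hZ - hZ'
  · intro a ha hneg
    have hsupp := (Finsupp.mem_supported ℂ _).1
      (sub_mem (S.residuesZ_mem_supported hg) (S'.residuesZ_mem_supported hg'))
    have hre : 0 < a.re := hsupp ha
    have hre' : 0 < (-a).re := hsupp hneg
    rw [Complex.neg_re] at hre'
    linarith

end Uniqueness

end DualCubicString

theorem mainTheorem9 {n : ℕ} (S : DualCubicString n) (hg : ∀ k, 0 < S.g k) :
    -- the normalized solution exists and is unique (off the masses), for every `lam`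
    (∀ lam : ℂ, S.IsNormalizedSolution lam (S.phi lam) ∧
      ∀ Φ, S.IsNormalizedSolution lam Φ →
        ∀ y ∈ Set.Icc (-1 : ℝ) 1, y ∉ Set.range S.y → Φ y = S.phi lam y) ∧
    (∃ (ev : Fin (n + 1) → ℝ) (b c : Fin n → ℝ),
      -- the spectrum is `0 = ev 0 < ev 1 < ⋯ < ev n`
      ev 0 = 0 ∧ StrictMono ev ∧
      S.spectrum = Set.range (fun j => (ev j : ℂ)) ∧
      -- simplicity: one-dimensional eigenspaces, and simple zeros of `φ₃(1; lam)`
      (∀ j Φ, S.IsEigenfunction (ev j) Φ →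
        ∃ a : ℂ, ∀ y ∈ Set.Icc (-1 : ℝ) 1, y ∉ Set.range S.y → Φ y = a • S.phi (ev j) y) ∧
      (∀ j, S.phi (ev j) 1 2 = 0 ∧ deriv (fun lam => S.phi lam 1 2) (ev j : ℂ) ≠ 0) ∧
      -- partial fractions of the Weyl functions, with positive residues
      (∀ k, 0 < b k) ∧ (∀ k, 0 < c k) ∧
      (∀ lam ∉ S.spectrum, S.weylW lam = ∑ k, (b k : ℂ) / (lam - ev k.succ)) ∧
      (∀ lam ∉ S.spectrum,
        S.weylZ lam = 1 / (2 * lam) + ∑ k, (c k : ℂ) / (lam - ev k.succ)) ∧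
      (∀ k, c k = ∑ m, b m * b k / (ev m.succ + ev k.succ))) ∧
    (∀ lam, lam ∉ S.spectrum → -lam ∉ S.spectrum →
      S.weylZ lam + S.weylZ (-lam) + S.weylW lam * S.weylW (-lam) = 0) ∧
    -- `Z` is determined by `W`
    (∀ (n' : ℕ) (S' : DualCubicString n'), (∀ k, 0 < S'.g k) →
      (∀ lam, lam ∉ S.spectrum → lam ∉ S'.spectrum → S.weylW lam = S'.weylW lam) →
      ∀ lam, lam ∉ S.spectrum → lam ∉ S'.spectrum → S.weylZ lam = S'.weylZ lam) := by
  have hg₀ : ∀ k, 0 ≤ S.g k := fun k => (hg k).le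
  have hroot := S.eval_endPoly_two_eigenvalue hg
  refine ⟨fun lam => ⟨S.isNormalizedSolution_phi lam, fun _ hΦ _ hy hyS => hΦ.eq_phi hy hyS⟩,
    ⟨S.eigenvalue hg, fun k => S.residue 1 (S.eigenvalue hg k.succ),
      fun k => S.residue 0 (S.eigenvalue hg k.succ), S.eigenvalue_zero hg,
      (S.eigenvalue hg).strictMono, S.spectrum_eq_range hg, ?_, ?_, ?_, ?_,
      fun _ => S.weylW_eq_sum hg, fun _ => S.weylZ_eq_sum hg, S.residue_zero_eq_sum hg⟩,
    fun _ => S.weylZ_add_weylZ_neg, fun _ _ hg' hW _ => S.weylZ_eq_of_weylW_eq hg hg' hW⟩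
  · exact fun _ Φ hΦ => ⟨Φ (-1) 0, fun _ hy hyS => hΦ.eq_smul_phi hy hyS⟩
  · exact fun j => ⟨S.phi_eigenvalue_one_two hg j, S.deriv_phi_eigenvalue_one_two_ne_zero hg j⟩
  · exact fun k => S.residue_one_pos hg₀ (S.eigenvalue_succ_pos hg k) (hroot k.succ)
  · exact fun k => S.residue_zero_pos hg₀ (hroot k.succ)
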